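/- A graphon is a measurable symmetric function $W:[0,1]^2\to[0,1]$; its shift operator on $L^2([0,1])$ is $(T_WX)(v)=\int_0^1W(u,v)X(u)\,du$. Its eigenvalues $\lambda_i(W)$, $i\in\mathbb Z\setminus\{0\}$, are the eigenvalues of $T_W$ with multiplicity, ordered $\lambda_1\ge\lambda_2\ge\dots\ge0\ge\dots\ge\lambda_{-2}\ge\lambda_{-1}$ and completed by zeros. For real coefficients $\mathbf h=(h_0,\dots,h_{K-1})$ put $h(\lambda)=\sum_{k<K}h_k\lambda^k$ and $\Phi(X;\mathbf h,W)=\sum_{k<K}h_kT_W^kX$. Norms are those of $L^2([0,1])$. Let $0<c\le1$, let $Y=\Phi(X;\mathbf h,W)$ with $X\in L^2([0,1])$, and assume: (AS1) $|W(u_2,v_2)-W(u_1,v_1)|\le A_w(|u_2-u_1|+|v_2-v_1|)$ on $[0,1]^2$; (AS2) $h$ is $A_h$-Lipschitz on $[-1,-c]\cup[c,1]$ and $a_h$-Lipschitz on $(-c,c)$, $a_h<A_h$, and $|h(\lambda)|<1$ for $\lambda\in[-1,1]$; (AS3) $|X(u)-X(v)|\le A_x|u-v|$ on $[0,1]$.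 Let $\chi_1,\chi_2\in(0,0.3]$ and $n\ge4/\chi_2$, and let $u_1\le\dots\le u_n$ be $n$ independent uniform random points of $[0,1]$, arranged in increasing order. The weighted graph $G$ on these node labels has shift operator $S_{ij}=W(u_i,u_j)$, and carries the graph signal $x_i=X(u_i)$. Let $I_1=[0,u_2)$, $I_i=[u_i,u_{i+1})$ for $1<i<n$, $I_n=[u_n,1]$, and let $$W_n(u,v)=\sum_{i,j}S_{ij}\mathbf 1(u\in I_i)\mathbf 1(v\in I_j),\qquad X_n(u)=\sum_ix_i\mathbf 1(u\in I_i)$$ be the induced graphon and graphon signal, and $Y_n=\Phi(X_n;\mathbf h,W_n)$. Let $$B^c=\#\{i:|\lambda_i(W_n)|\ge c\},\qquad \delta^c=\inf\{|\lambda_i(W_n)-\lambda_j(W)|:\ j\ne i,\ |\lambda_i(W_n)|\ge c\},$$ $$\alpha(n,\chi)=\log\frac{(n+1)^2}{\log\big((1-\chi)^{-1}\big)},$$ where $\inf\emptyset=\infty$. Then, with probability at least $[1-2\chi_1][1-\chi_2]$, $$\|Y_n-Y\|\le\Big(A_h+\frac{\pi B^c}{\delta^c}\Big)\frac{2A_w\,\alpha(n,\chi_1)}n\|X\|+\frac{A_x\,\alpha(n,\chi_1)(a_hc+2)}n+2a_hc\|X\|,$$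 where the bound is void (its right-hand side is read as $+\infty$) if $\delta^c=0$. -/

import Mathlib

open MeasureTheory ProbabilityTheory
open scoped unitInterval ENNReal

noncomputable section

/-- The Hilbert space `L²([0,1])`, with Lebesgue measure on `[0,1]`. -/
abbrev L2I : Type := Lp ℝ 2 (volume : Measure I)

/-- A graphon: a measurable symmetric kernel `[0,1]² → [0,1]`. -/
structure Graphon where
  toFun : I → I → ℝ
  measurable' : Measurable (Function.uncurry toFun)
  symm' : ∀ s t, toFun s t = toFun t s
  mem_Icc' : ∀ s t, toFun s t ∈ Set.Icc (0 : ℝ) 1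

instance : CoeFun Graphon (fun _ => I → I → ℝ) := ⟨Graphon.toFun⟩

/-- A graphon signal: a square-integrable function on `[0,1]`. -/
structure GraphonSignal where
  toFun : I → ℝ
  memLp' : MemLp toFun 2 (volume : Measure I)

instance : CoeFun GraphonSignal (fun _ => I → ℝ) := ⟨GraphonSignal.toFun⟩

/-- The class of a graphon signal in `L²([0,1])`. -/
def GraphonSignal.toL2 (X : GraphonSignal) : L2I := X.memLp'.toLp X.toFun

namespace Graphon

theorem integrable_mul (W : Graphon) (X : L2I) (v : I) :
    Integrable (fun u => W u v * X u) (volume : Measure I) := by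
  have hX : Integrable (fun u => X u) (volume : Measure I) :=
    (Lp.memLp X).integrable (by norm_num)
  refine hX.bdd_mul (c := 1) ?_ ?_
  · exact (W.measurable'.comp (measurable_id.prodMk measurable_const)).aestronglyMeasurable
  · refine Filter.Eventually.of_forall fun u => ?_
    have := W.mem_Icc' u v
    rw [Real.norm_eq_abs, abs_of_nonneg this.1]
    exact this.2

theorem norm_integral_le (W : Graphon) (X : L2I) (v : I) :
    ‖∫ u, W u v * X u‖ ≤ ‖X‖ := by
  have hX : Integrable (fun u => X u) (volume : Measure I) :=
    (Lp.memLp X).integrable (by norm_num)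
  calc ‖∫ u, W u v * X u‖ ≤ ∫ u, ‖X u‖ := by
        refine norm_integral_le_of_norm_le hX.norm (Filter.Eventually.of_forall fun u => ?_)
        have := W.mem_Icc' u v
        rw [norm_mul, Real.norm_eq_abs, abs_of_nonneg this.1]
        exact mul_le_of_le_one_left (norm_nonneg _) this.2
    _ = (eLpNorm X 1 (volume : Measure I)).toReal := by
        rw [integral_norm_eq_lintegral_enorm hX.1, eLpNorm_one_eq_lintegral_enorm]
    _ ≤ (eLpNorm X 2 (volume : Measure I)).toReal :=
        ENNReal.toReal_mono (Lp.memLp X).2.ne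
          (eLpNorm_le_eLpNorm_of_exponent_le (by norm_num) (Lp.memLp X).1)
    _ = ‖X‖ := rfl

theorem memLp_integral (W : Graphon) (X : L2I) :
    MemLp (fun v => ∫ u, W u v * X u) 2 (volume : Measure I) := by
  refine MemLp.of_bound ?_ ‖X‖ (Filter.Eventually.of_forall fun v => W.norm_integral_le X v)
  refine AEStronglyMeasurable.integral_prod_right'
    (f := fun p : I × I => W p.2 p.1 * X p.2) ?_
  refine AEStronglyMeasurable.mul ?_ ?_
  · exact (W.measurable'.comp measurable_swap).aestronglyMeasurable
  · exact (Lp.memLp X).1.comp_snd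

/-- The graphon shift operator `(T_W X)(v) = ∫₀¹ W(u,v) X(u) du` on `L²([0,1])`. -/
def shift (W : Graphon) : L2I →L[ℝ] L2I :=
  LinearMap.mkContinuous
    { toFun := fun X => (W.memLp_integral X).toLp _
      map_add' := fun X Y => by
        rw [← MemLp.toLp_add]
        refine MemLp.toLp_congr _ _ (Filter.Eventually.of_forall fun v => ?_)
        simp only [Pi.add_apply]
        rw [← integral_add (W.integrable_mul X v) (W.integrable_mul Y v)]
        refine integral_congr_ae ?_
        filter_upwards [Lp.coeFn_add X Y] with u hu
        rw [hu, Pi.add_apply, mul_add]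
      map_smul' := fun a X => by
        rw [RingHom.id_apply, ← MemLp.toLp_const_smul]
        refine MemLp.toLp_congr _ _ (Filter.Eventually.of_forall fun v => ?_)
        simp only [Pi.smul_apply, smul_eq_mul]
        rw [← integral_const_mul]
        refine integral_congr_ae ?_
        filter_upwards [Lp.coeFn_smul a X] with u hu
        rw [hu, Pi.smul_apply, smul_eq_mul]
        ring }
    1 fun X => by
      have h : ∀ᵐ v ∂(volume : Measure I),
          ‖((W.memLp_integral X).toLp _ : L2I) v‖ ≤ ‖X‖ := by
        filter_upwards [(W.memLp_integral X).coeFn_toLp] with v hv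
        rw [hv]
        exact W.norm_integral_le X v
      have := Lp.norm_le_of_ae_bound (norm_nonneg X) h
      have h1 : measureUnivNNReal (volume : Measure I) = 1 := by simp [measureUnivNNReal]
      rw [h1] at this
      simpa using this

/-- The convolutional graphon filter `T_H = ∑_{k<K} h_k T_W^k`. -/
def filter (W : Graphon) {K : ℕ} (h : Fin K → ℝ) : L2I →L[ℝ] L2I :=
  ∑ k : Fin K, h k • W.shift ^ (k : ℕ)

end Graphon

/-- The spectral response `h(x) = ∑_{k<K} h_k x^k` of the filter with coefficients `h`. -/
def spectralResponse {K : ℕ} (h : Fin K → ℝ) (x : ℝ) : ℝ :=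
  ∑ k : Fin K, h k * x ^ (k : ℕ)

/-- For `k ≥ 1`: the `k`-th largest positive eigenvalue of `T`, counted with multiplicity, that is
the largest `t > 0` such that the eigenvectors with eigenvalues at least `t` span a space of
dimension at least `k`; it is `0` if `T` has fewer than `k` positive eigenvalues. -/
def posEigenvalue (T : L2I →L[ℝ] L2I) (k : ℕ) : ℝ :=
  sSup {t : ℝ | 0 < t ∧ (k : Cardinal) ≤
    Module.rank ℝ ↥(⨆ x ∈ Set.Ici t, Module.End.eigenspace (T : L2I →ₗ[ℝ] L2I) x)}

/-- The index set `ℤ \ {0}` of the eigenvalues. -/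
abbrev EigIndex : Type := {i : ℤ // i ≠ 0}

/-- The eigenvalues of the graphon `W`, i.e. those of `T_W`, with multiplicity and indexed by
`ℤ \ {0}`: `λ₁ ≥ λ₂ ≥ … ≥ 0 ≥ … ≥ λ₋₂ ≥ λ₋₁`, both halves completed by zeros if finite. -/
def Graphon.eigenvalue (W : Graphon) (i : EigIndex) : ℝ :=
  if 0 < i.1 then posEigenvalue W.shift i.1.toNat
  else -posEigenvalue (-W.shift) (-i.1).toNat

/-- The `c`-band cardinality: the number of eigenvalues, with multiplicity, of absolute value at
least `c`. -/
def Graphon.bandCard (W : Graphon) (c : ℝ) : ℕ :=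
  {i : EigIndex | c ≤ |W.eigenvalue i|}.ncard

/-- The `c`-eigenvalue margin of `W` and `W'`: the infimum of `|λ_i(W') - λ_j(W)|` over `i` with
`|λ_i(W')| ≥ c` and `j ≠ i`. It is `∞` if there is no such `i`. -/
def eigenvalueMargin (W W' : Graphon) (c : ℝ) : ℝ≥0∞ :=
  ⨅ (i : EigIndex) (j : EigIndex) (_ : j ≠ i) (_ : c ≤ |W'.eigenvalue i|),
    ENNReal.ofReal |W'.eigenvalue i - W.eigenvalue j|

/-- The node stochasticity constant. -/
def nodeStochasticity (n : ℕ) (χ : ℝ) : ℝ :=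
  Real.log (((n : ℝ) + 1) ^ 2 / Real.log (1 - χ)⁻¹)

/-- An undirected `n`-node graph with edge weights in `[0,1]`, whose nodes carry labels in `[0,1]`
and are numbered in nondecreasing order of their labels. -/
structure LabeledGraph (n : ℕ) where
  /-- The graph shift operator. -/
  gso : Matrix (Fin n) (Fin n) ℝ
  /-- The node labels. -/
  label : Fin n → I
  label_mono : Monotone label
  gso_symm : ∀ i j, gso i j = gso j i
  gso_mem_Icc : ∀ i j, gso i j ∈ Set.Icc (0 : ℝ) 1

/-- The weighted graph generated from `W` by node labels `U`: the nodes are numbered by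
increasing label, `u₁ ≤ … ≤ u_n`, and the weight of `(i,j)` is `W(u_i,u_j)`. -/
def weightedGraph (W : Graphon) {n : ℕ} (U : Fin n → I) : LabeledGraph n where
  gso := Matrix.of fun i j => W (U (Tuple.sort U i)) (U (Tuple.sort U j))
  label := U ∘ Tuple.sort U
  label_mono := Tuple.monotone_sort U
  gso_symm := fun _ _ => W.symm' _ _
  gso_mem_Icc := fun _ _ => W.mem_Icc' _ _

namespace LabeledGraph

variable {n : ℕ} (G : LabeledGraph n)

/-- The interval of `[0,1]` represented by node `i`: `I₁ = [0,u₂)`, `I_i = [u_i,u_{i+1})` for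
`1 < i < n`, and `I_n = [u_n,1]` (`I₁ = [0,1]` if `n = 1`). The initial piece `[0,u₁)` belongs to
the node with the nearest label. -/
def cell (i : Fin n) : Set I :=
  {t | (i.val = 0 ∨ G.label i ≤ t) ∧ ∀ hi : i.val + 1 < n, t < G.label ⟨i.val + 1, hi⟩}

/-- The indicator function of the interval of node `i`. -/
def cellInd (i : Fin n) : I → ℝ := (G.cell i).indicator fun _ => 1

theorem measurableSet_cell (i : Fin n) : MeasurableSet (G.cell i) := by
  have h : G.cell i = ({_t | i.val = 0} ∪ Set.Ici (G.label i)) ∩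
      ⋂ hi : i.val + 1 < n, Set.Iio (G.label ⟨i.val + 1, hi⟩) := by
    ext t
    simp [cell]
  rw [h]
  exact ((MeasurableSet.const _).union measurableSet_Ici).inter
    (MeasurableSet.iInter fun _ => measurableSet_Iio)

theorem measurable_cellInd (i : Fin n) : Measurable (G.cellInd i) :=
  measurable_const.indicator (G.measurableSet_cell i)

theorem cellInd_nonneg (i : Fin n) (t : I) : 0 ≤ G.cellInd i t :=
  Set.indicator_nonneg (fun _ _ => zero_le_one) t

theorem cell_disjoint {i j : Fin n} (hij : i < j) {t : I} (hi : t ∈ G.cell i) :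
    t ∉ G.cell j := by
  rintro ⟨hj, -⟩
  have hlt : i.val < j.val := hij
  have h1 : i.val + 1 < n := lt_of_le_of_lt hlt j.2
  have h2 := hi.2 h1
  have h3 : G.label ⟨i.val + 1, h1⟩ ≤ G.label j := G.label_mono hlt
  rcases hj with hj | hj
  · omega
  · exact absurd (h2.trans_le (h3.trans hj)) (lt_irrefl _)

theorem sum_cellInd_le_one (t : I) : ∑ i, G.cellInd i t ≤ 1 := by
  by_cases h : ∃ i, t ∈ G.cell i
  · obtain ⟨i, hi⟩ := h
    rw [Finset.sum_eq_single i]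
    · simp [cellInd, hi]
    · intro j _ hj
      refine Set.indicator_of_notMem ?_ _
      rcases lt_or_gt_of_ne hj with hlt | hlt
      · exact fun h' => G.cell_disjoint hlt h' hi
      · exact G.cell_disjoint hlt hi
    · simp
  · push Not at h
    have h0 : ∑ i, G.cellInd i t = 0 :=
      Finset.sum_eq_zero fun i _ => Set.indicator_of_notMem (h i) _
    rw [h0]
    exact zero_le_one

/-- The graphon induced by the graph `G`:
`W_G(s,t) = ∑_i ∑_j S_{ij} 1(s ∈ I_i) 1(t ∈ I_j)`. -/
def inducedGraphon : Graphon where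
  toFun := fun s t => ∑ i, ∑ j, G.gso i j * G.cellInd i s * G.cellInd j t
  measurable' := by
    refine Finset.measurable_sum _ fun i _ => Finset.measurable_sum _ fun j _ => ?_
    exact (measurable_const.mul ((G.measurable_cellInd i).comp measurable_fst)).mul
      ((G.measurable_cellInd j).comp measurable_snd)
  symm' := fun s t => by
    rw [Finset.sum_comm]
    refine Finset.sum_congr rfl fun i _ => Finset.sum_congr rfl fun j _ => ?_
    rw [G.gso_symm]
    ring
  mem_Icc' := fun s t => by
    constructor
    · exact Finset.sum_nonneg fun i _ => Finset.sum_nonneg fun j _ =>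
        mul_nonneg (mul_nonneg (G.gso_mem_Icc i j).1 (G.cellInd_nonneg i s))
          (G.cellInd_nonneg j t)
    · calc ∑ i, ∑ j, G.gso i j * G.cellInd i s * G.cellInd j t
          ≤ ∑ i, ∑ j, G.cellInd i s * G.cellInd j t := by
            refine Finset.sum_le_sum fun i _ => Finset.sum_le_sum fun j _ => ?_
            exact mul_le_mul_of_nonneg_right
              (mul_le_of_le_one_left (G.cellInd_nonneg i s) (G.gso_mem_Icc i j).2)
              (G.cellInd_nonneg j t)
        _ = (∑ i, G.cellInd i s) * ∑ j, G.cellInd j t := by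
            rw [Finset.sum_mul_sum]
        _ ≤ 1 := mul_le_one₀ (G.sum_cellInd_le_one s)
            (Finset.sum_nonneg fun j _ => G.cellInd_nonneg j t) (G.sum_cellInd_le_one t)

/-- The graphon signal induced by a graph signal `x` on `G`: `X_G(t) = ∑_i x_i 1(t ∈ I_i)`. -/
def inducedSignal (x : Fin n → ℝ) : GraphonSignal where
  toFun := fun t => ∑ i, x i * G.cellInd i t
  memLp' := by
    refine memLp_finsetSum _ fun i _ => ?_
    exact ((memLp_const (1 : ℝ)).indicator (G.measurableSet_cell i)).const_mul (x i)

/-- The graph signal `x_i = X(u_i)` obtained from the graphon signal `X` at the node labels. -/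
def sampledSignal (X : GraphonSignal) : Fin n → ℝ := fun i => X (G.label i)

end LabeledGraph

end

/-! A filter is a polynomial h(T) in a compact self-adjoint contraction T. If h is A-Lipschitz on
[-1,1], then h is A-Lipschitz on such operators as well, once their difference is measured in
Hilbert–Schmidt norm (`norm_aeval_sub_aeval_le`). On a unit eigenvector e of T with eigenvalue λ,
(h(S) - h(T))e = (h(S) - h(λ))e, and the spectral theorem for S bounds its norm by A‖(S - λ)e‖ =
A‖(S - T)e‖; Cauchy–Schwarz over an eigenbasis of T does the rest. Eigenvalues of S and T are never
matched, so no spectral gap enters. The result is the stronger bound A_h (2 A_w α/n) ‖X‖ + A_x α/n;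
the margin term and the terms in a_h c are slack.

It remains to control the sampling. If every point of [0,1] is within ε = α/n of the label of its
node, then W_n is uniformly 2 A_w ε-close to W, which bounds the Hilbert–Schmidt norm, and X_n is
A_x ε-close to X; since |h| < 1, the filter does not amplify the latter error
(`norm_filter_sampled_sub_le`). The labels are that dense as soon as they hit all grid windows [k/n,
k/n + (α-1)/n] inside [0,1]. A union bound (`exists_event_hits_windows`) makes the failure
probability at most n exp(-(α-1)), and `one_le_nodeStochasticity` bounds this by 1.4 χ₁. -/

/-! ### Polynomials of compact self-adjoint operators -/

section SpectralTheory

open Polynomial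

universe u

variable {H : Type u} [NormedAddCommGroup H] [InnerProductSpace ℝ H]

/-- The eigenspaces, the kernel included, are mutually orthogonal and jointly total, so Hilbert
bases of the individual eigenspaces together form one of `H`. -/
theorem exists_hilbertBasis_eigenvectors [CompleteSpace H] (T : H →L[ℝ] H)
    (hT : IsCompactOperator T) (hs : (T : H →ₗ[ℝ] H).IsSymmetric) :
    ∃ (ι : Type u) (b : HilbertBasis ι ℝ H) (eig : ι → ℝ), ∀ i, T (b i) = eig i • b i := by
  have hclosed : ∀ x : ℝ, IsClosed
      (Module.End.eigenspace (T : H →ₗ[ℝ] H) x : Set H) := fun x => by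
    have : (Module.End.eigenspace (T : H →ₗ[ℝ] H) x : Set H) = {v | T v = x • v} := by
      ext v
      exact Module.End.mem_eigenspace_iff
    rw [this]
    exact isClosed_eq T.continuous (continuous_const_smul x)
  have hcomplete : ∀ x : ℝ, CompleteSpace (Module.End.eigenspace (T : H →ₗ[ℝ] H) x) :=
    fun x => (hclosed x).completeSpace_coe
  choose w b hb using fun x : ℝ =>
    exists_hilbertBasis ℝ (Module.End.eigenspace (T : H →ₗ[ℝ] H) x)
  let v : (Σ x : ℝ, w x) → H := fun a => (b a.1 a.2 : H)
  have hv : Orthonormal ℝ v :=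
    hs.orthogonalFamily_eigenspaces.orthonormal_sigma_orthonormal fun x => (b x).orthonormal
  -- A vector orthogonal to all chosen basis vectors is orthogonal to each whole eigenspace, by
  -- expanding an eigenvector in the basis of its eigenspace and taking inner products termwise.
  have htotal : (Submodule.span ℝ (Set.range v))ᗮ = ⊥ := by
    have hbot := ContinuousLinearMap.orthogonalComplement_iSup_eigenspaces_eq_bot (T := T) hT hs
    rw [eq_bot_iff, ← hbot, ← Submodule.iInf_orthogonal]
    intro y hy
    rw [Submodule.mem_iInf]
    intro x z hz
    have hsum := (b x).hasSum_repr ⟨z, hz⟩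
    have hsum' := ((hsum.mapL (Submodule.subtypeL _)).mapL (innerSL ℝ y))
    have hzero : ∀ i, innerSL ℝ y (Submodule.subtypeL _ ((b x).repr ⟨z, hz⟩ i • b x i)) = 0 := by
      intro i
      have : inner ℝ (v ⟨x, i⟩) y = 0 :=
        hy _ (Submodule.subset_span ⟨⟨x, i⟩, rfl⟩)
      rw [real_inner_comm] at this
      simp only [map_smul, innerSL_apply_apply, Submodule.subtypeL_apply]
      rw [this, smul_zero]
    simp only [hzero] at hsum'
    rw [real_inner_comm]
    exact hsum'.unique hasSum_zero
  refine ⟨_, HilbertBasis.mkOfOrthogonalEqBot hv htotal, fun a => a.1, fun a => ?_⟩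
  rw [HilbertBasis.coe_mkOfOrthogonalEqBot]
  exact Module.End.mem_eigenspace_iff.mp (b a.1 a.2).2

theorem HilbertBasis.hasSum_inner_sq {ι : Type*} (b : HilbertBasis ι ℝ H) (x : H) :
    HasSum (fun i => inner ℝ (b i) x ^ 2) (‖x‖ ^ 2) := by
  have := b.hasSum_inner_mul_inner x x
  rw [real_inner_self_eq_norm_sq] at this
  refine this.congr_fun fun i => ?_
  rw [real_inner_comm x (b i), sq]

theorem aeval_apply_of_eigenvector (T : H →L[ℝ] H) {v : H} {x : ℝ} (hv : T v = x • v)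
    (p : ℝ[X]) : aeval T p v = p.eval x • v := by
  induction p using Polynomial.induction_on' with
  | add p q hp hq => simp [hp, hq, add_smul]
  | monomial k a =>
    have hk : ∀ k : ℕ, (T ^ k) v = x ^ k • v := fun k => by
      induction k with
      | zero => simp
      | succ k ih => rw [pow_succ', mul_apply_eq_comp, ih, map_smul, hv, smul_smul,
          pow_succ]
    simp [aeval_monomial, Algebra.algebraMap_eq_smul_one, hk, smul_smul]

theorem inner_aeval_of_eigenvector {T : H →L[ℝ] H} (hs : (T : H →ₗ[ℝ] H).IsSymmetric)
    {v : H} {x : ℝ} (hv : T v = x • v) (p : ℝ[X]) (y : H) :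
    inner ℝ v (aeval T p y) = p.eval x * inner ℝ v y := by
  have h1 : ∀ y, inner ℝ v (T y) = x * inner ℝ v y := fun y => by
    have := hs v y
    simp only [ContinuousLinearMap.coe_coe] at this
    rw [← this, hv, real_inner_smul_left]
  induction p using Polynomial.induction_on' with
  | add p q hp hq => simp [hp, hq, add_mul, inner_add_right]
  | monomial k a =>
    have hk : ∀ k : ℕ, inner ℝ v ((T ^ k) y) = x ^ k * inner ℝ v y := fun k => by
      induction k with
      | zero => simp
      | succ k ih => rw [pow_succ', mul_apply_eq_comp, h1, ih, pow_succ']; ring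
    simp [aeval_monomial, Algebra.algebraMap_eq_smul_one, inner_smul_right, mul_assoc, ← hk]

theorem abs_eigenvalue_le_one {T : H →L[ℝ] H} (hn : ‖T‖ ≤ 1) {v : H} (hv1 : ‖v‖ = 1) {x : ℝ}
    (hv : T v = x • v) : x ∈ Set.Icc (-1 : ℝ) 1 := by
  have := T.le_opNorm v
  rw [hv, norm_smul, hv1, mul_one, mul_one] at this
  exact abs_le.mp (this.trans hn)

/-- Parseval in an eigenbasis: the coefficients of `y` get multiplied by the values of the
polynomial at the eigenvalues, which lie in [-1,1]. -/
theorem norm_aeval_le_norm_aeval [CompleteSpace H] {T : H →L[ℝ] H} (hT : IsCompactOperator T)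
    (hs : (T : H →ₗ[ℝ] H).IsSymmetric) (hn : ‖T‖ ≤ 1) {p q : ℝ[X]}
    (hpq : ∀ x ∈ Set.Icc (-1 : ℝ) 1, |p.eval x| ≤ |q.eval x|) (y : H) :
    ‖aeval T p y‖ ≤ ‖aeval T q y‖ := by
  obtain ⟨ι, b, eig, hb⟩ := exists_hilbertBasis_eigenvectors T hT hs
  refine le_of_sq_le_sq ?_ (norm_nonneg _)
  refine hasSum_le (fun i => ?_) (b.hasSum_inner_sq _) (b.hasSum_inner_sq _)
  rw [inner_aeval_of_eigenvector hs (hb i), inner_aeval_of_eigenvector hs (hb i), mul_pow, mul_pow]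
  exact mul_le_mul_of_nonneg_right
    (sq_le_sq.mpr (hpq _ (abs_eigenvalue_le_one hn (b.orthonormal.1 i) (hb i)))) (sq_nonneg _)

/-- A polynomial that is Lipschitz on `[-1,1]` is Lipschitz as a function of compact self-adjoint
contractions, with respect to the Hilbert–Schmidt norm of the difference. -/
theorem norm_aeval_sub_aeval_le [CompleteSpace H] {S T : H →L[ℝ] H}
    (hSc : IsCompactOperator S) (hS : (S : H →ₗ[ℝ] H).IsSymmetric) (hS1 : ‖S‖ ≤ 1)
    (hTc : IsCompactOperator T) (hT : (T : H →ₗ[ℝ] H).IsSymmetric) (hT1 : ‖T‖ ≤ 1)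
    {p : ℝ[X]} {A : ℝ} (hA : 0 ≤ A)
    (hp : ∀ x ∈ Set.Icc (-1 : ℝ) 1, ∀ y ∈ Set.Icc (-1 : ℝ) 1,
      |p.eval x - p.eval y| ≤ A * |x - y|)
    {η : ℝ} (hη : 0 ≤ η)
    (hHS : ∀ {ι : Type u} (v : ι → H), Orthonormal ℝ v → ∀ s : Finset ι,
      ∑ i ∈ s, ‖(S - T) (v i)‖ ^ 2 ≤ η ^ 2) (y : H) :
    ‖aeval S p y - aeval T p y‖ ≤ A * η * ‖y‖ := by
  obtain ⟨ι, b, eig, hb⟩ := exists_hilbertBasis_eigenvectors T hTc hT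
  have hbasis : ∀ i, ‖(aeval S p - aeval T p) (b i)‖ ≤ A * ‖(S - T) (b i)‖ := by
    intro i
    have hmem := abs_eigenvalue_le_one hT1 (b.orthonormal.1 i) (hb i)
    -- The Lipschitz condition with one argument frozen at the eigenvalue λ of `T` says that p -
    -- p(λ) is dominated by A(X - λ) on [-1,1]; this is applied to `S`, at the eigenvector of `T`.
    have key := norm_aeval_le_norm_aeval hSc hS hS1 (p := p - C (p.eval (eig i)))
      (q := C A * (X - C (eig i))) (fun x hx => by
        simpa [abs_mul, abs_of_nonneg hA] using hp x hx _ hmem) (b i)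
    have e1 : aeval S (p - C (p.eval (eig i))) (b i) = (aeval S p - aeval T p) (b i) := by
      simp [aeval_apply_of_eigenvector T (hb i), Algebra.algebraMap_eq_smul_one]
    have e2 : aeval S (C A * (X - C (eig i))) (b i) = A • (S - T) (b i) := by
      simp [hb i, Algebra.algebraMap_eq_smul_one]
    rwa [e1, e2, norm_smul, Real.norm_of_nonneg hA] at key
  have hsum := (b.hasSum_repr y).mapL (aeval S p - aeval T p)
  have hle : ∀ s : Finset ι,
      ‖∑ i ∈ s, (aeval S p - aeval T p) (b.repr y i • b i)‖ ≤ A * η * ‖y‖ := by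
    intro s
    have h1 : ‖∑ i ∈ s, (aeval S p - aeval T p) (b.repr y i • b i)‖ ≤
        ∑ i ∈ s, |inner ℝ (b i) y| * (A * ‖(S - T) (b i)‖) := by
      refine norm_sum_le_of_le s fun i _ => ?_
      rw [map_smul, norm_smul, b.repr_apply_apply, Real.norm_eq_abs]
      exact mul_le_mul_of_nonneg_left (hbasis i) (abs_nonneg _)
    -- Cauchy–Schwarz separates the coefficients of `y`, square-summable to at most ‖y‖², from the
    -- Hilbert–Schmidt sum.
    refine h1.trans (le_of_sq_le_sq ?_ (by positivity))
    refine (Finset.sum_mul_sq_le_sq_mul_sq s _ _).trans ?_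
    have h2 : ∑ i ∈ s, |inner ℝ (b i) y| ^ 2 ≤ ‖y‖ ^ 2 := by
      simp only [sq_abs]
      exact sum_le_hasSum s (fun i _ => sq_nonneg _) (b.hasSum_inner_sq y)
    have h3 : ∑ i ∈ s, (A * ‖(S - T) (b i)‖) ^ 2 ≤ A ^ 2 * η ^ 2 := by
      simp only [mul_pow, ← Finset.mul_sum]
      exact mul_le_mul_of_nonneg_left (hHS _ b.orthonormal s) (sq_nonneg _)
    calc _ ≤ ‖y‖ ^ 2 * (A ^ 2 * η ^ 2) := by
          exact mul_le_mul h2 h3 (Finset.sum_nonneg fun i _ => sq_nonneg _) (sq_nonneg _)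
      _ = (A * η * ‖y‖) ^ 2 := by ring
  have := le_of_tendsto (hsum.norm) (Filter.Eventually.of_forall hle)
  simpa using this

end SpectralTheory

/-! ### Shift operators: symmetry and the Hilbert–Schmidt estimate -/

theorem L2I.norm_sq_eq_integral (f : L2I) : ‖f‖ ^ 2 = ∫ t, f t ^ 2 := by
  rw [← real_inner_self_eq_norm_sq, L2.inner_def]
  refine integral_congr_ae (Filter.Eventually.of_forall fun t => ?_)
  simp [sq]

theorem L2I.norm_le_of_ae_bound {f : L2I} {C : ℝ} (hC : 0 ≤ C) (hf : ∀ᵐ t, |f t| ≤ C) :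
    ‖f‖ ≤ C := by
  have h := Lp.norm_le_of_ae_bound (f := f) hC hf
  have h1 : measureUnivNNReal (volume : Measure I) = 1 := by simp [measureUnivNNReal]
  rw [h1] at h
  simpa using h

namespace Graphon

theorem shift_coeFn (W : Graphon) (X : L2I) : W.shift X =ᵐ[volume] fun v => ∫ u, W u v * X u :=
  (W.memLp_integral X).coeFn_toLp

theorem norm_shift_le_one (W : Graphon) : ‖W.shift‖ ≤ 1 :=
  LinearMap.mkContinuous_norm_le _ zero_le_one _

theorem abs_le_one (W : Graphon) (u v : I) : |W u v| ≤ 1 :=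
  abs_le.mpr ⟨by linarith [(W.mem_Icc' u v).1], (W.mem_Icc' u v).2⟩

theorem isSymmetric_shift (W : Graphon) : (W.shift : L2I →ₗ[ℝ] L2I).IsSymmetric := by
  intro X Y
  have hX : Integrable (fun u => X u) (volume : Measure I) :=
    (Lp.memLp X).integrable (by norm_num)
  have hY : Integrable (fun u => Y u) (volume : Measure I) :=
    (Lp.memLp Y).integrable (by norm_num)
  have hint : Integrable (Function.uncurry fun v u : I => W u v * (Y v * X u))
      ((volume : Measure I).prod volume) := by
    refine (hY.mul_prod hX).bdd_mul (c := 1) ?_ (Filter.Eventually.of_forall fun p => ?_)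
    · exact (W.measurable'.comp measurable_swap).aestronglyMeasurable
    · exact W.abs_le_one _ _
  simp only [ContinuousLinearMap.coe_coe, L2.inner_def]
  have h1 : ∫ v, inner ℝ (W.shift X v) (Y v) = ∫ v, ∫ u, W u v * (Y v * X u) := by
    refine integral_congr_ae ?_
    filter_upwards [W.shift_coeFn X] with v hv
    rw [hv, RCLike.inner_apply, conj_trivial, ← integral_const_mul]
    refine integral_congr_ae (Filter.Eventually.of_forall fun u => ?_)
    simp only
    ring
  have h2 : ∫ u, inner ℝ (X u) (W.shift Y u) = ∫ u, ∫ v, W u v * (Y v * X u) := by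
    refine integral_congr_ae ?_
    filter_upwards [W.shift_coeFn Y] with u hu
    rw [hu, RCLike.inner_apply, conj_trivial, ← integral_mul_const]
    refine integral_congr_ae (Filter.Eventually.of_forall fun v => ?_)
    simp only
    rw [W.symm' v u]
    ring
  rw [h1, h2]
  exact integral_integral_swap hint

theorem memLp_section_sub (W W' : Graphon) (v : I) :
    MemLp (fun u => W u v - W' u v) 2 (volume : Measure I) := by
  refine MemLp.of_bound ?_ 2 (Filter.Eventually.of_forall fun u => ?_)
  · exact ((W.measurable'.comp (measurable_id.prodMk measurable_const)).sub
      (W'.measurable'.comp (measurable_id.prodMk measurable_const))).aestronglyMeasurable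
  · exact (abs_sub _ _).trans (by linarith [W.abs_le_one u v, W'.abs_le_one u v])

/-- The Hilbert–Schmidt norm of a difference of shift operators is at most the uniform distance of
the graphons. -/
theorem sum_norm_sq_shift_sub_le {W W' : Graphon} {η : ℝ} (hη : 0 ≤ η)
    (h : ∀ u v, |W u v - W' u v| ≤ η) {ι : Type*} {e : ι → L2I} (he : Orthonormal ℝ e)
    (s : Finset ι) : ∑ i ∈ s, ‖(W.shift - W'.shift) (e i)‖ ^ 2 ≤ η ^ 2 := by
  let k : I → L2I := fun v => (memLp_section_sub W W' v).toLp _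
  have hk : ∀ v, ‖k v‖ ≤ η := fun v => by
    refine L2I.norm_le_of_ae_bound hη ?_
    filter_upwards [(memLp_section_sub W W' v).coeFn_toLp] with u hu
    rw [hu]
    exact h u v
  -- The value at `v` is an inner product with the section `k v` of the kernel difference, so
  -- Bessel's inequality for `k v` can be used at almost every `v` and then integrated.
  have hD : ∀ Z : L2I, ∀ᵐ v, (W.shift - W'.shift) Z v = inner ℝ Z (k v) := fun Z => by
    have hsub : (W.shift - W'.shift) Z = W.shift Z - W'.shift Z := rfl
    rw [hsub]
    filter_upwards [Lp.coeFn_sub (W.shift Z) (W'.shift Z), W.shift_coeFn Z, W'.shift_coeFn Z]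
      with v h1 h2 h3
    rw [h1, Pi.sub_apply, h2, h3, ← integral_sub (W.integrable_mul Z v) (W'.integrable_mul Z v),
      L2.inner_def]
    refine integral_congr_ae ?_
    filter_upwards [(memLp_section_sub W W' v).coeFn_toLp] with u hu
    rw [hu, RCLike.inner_apply, conj_trivial]
    ring
  have hint : ∀ Z : L2I, Integrable (fun v => (W.shift - W'.shift) Z v ^ 2) volume :=
    fun Z => (Lp.memLp _).integrable_sq
  simp only [L2I.norm_sq_eq_integral]
  rw [← integral_finsetSum s fun i _ => hint (e i)]
  have hbound : ∀ᵐ v, ∑ i ∈ s, (W.shift - W'.shift) (e i) v ^ 2 ≤ η ^ 2 := by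
    have hall : ∀ᵐ v, ∀ i ∈ s, (W.shift - W'.shift) (e i) v = inner ℝ (e i) (k v) :=
      (Finset.eventually_all s).mpr fun i _ => hD (e i)
    filter_upwards [hall] with v hv
    rw [Finset.sum_congr rfl fun i hi => by rw [hv i hi]]
    have hbessel := he.sum_inner_products_le (x := k v) (s := s)
    simp only [Real.norm_eq_abs, sq_abs] at hbessel
    exact hbessel.trans (pow_le_pow_left₀ (norm_nonneg _) (hk v) 2)
  refine (integral_mono_ae (integrable_finsetSum s fun i _ => hint (e i))
    (integrable_const _) hbound).trans ?_
  simp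

/-- The Hilbert–Schmidt estimate for an orthonormal family with a single member. -/
theorem norm_shift_sub_le {W W' : Graphon} {η : ℝ} (hη : 0 ≤ η)
    (h : ∀ u v, |W u v - W' u v| ≤ η) : ‖W.shift - W'.shift‖ ≤ η := by
  refine ContinuousLinearMap.opNorm_le_of_unit_norm hη fun X hX => ?_
  have he : Orthonormal ℝ fun _ : Unit => X := ⟨fun _ => hX, fun i j hij => (hij rfl).elim⟩
  have := sum_norm_sq_shift_sub_le hη h he Finset.univ
  simp only [Finset.univ_unique, Finset.sum_const, Finset.card_singleton, one_smul] at this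
  exact le_of_sq_le_sq this hη

theorem filter_eq_aeval (W : Graphon) {K : ℕ} (h : Fin K → ℝ) :
    W.filter h = Polynomial.aeval W.shift
      (∑ k : Fin K, Polynomial.C (h k) * Polynomial.X ^ (k : ℕ)) := by
  simp [filter, Algebra.smul_def]

end Graphon

theorem spectralResponse_eq_eval {K : ℕ} (h : Fin K → ℝ) (x : ℝ) :
    spectralResponse h x =
      (∑ k : Fin K, Polynomial.C (h k) * Polynomial.X ^ (k : ℕ)).eval x := by
  simp [spectralResponse, Polynomial.eval_finsetSum]

/-! ### Induced graphons: finite rank and values on cells -/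

namespace LabeledGraph

variable {n : ℕ} (G : LabeledGraph n)

theorem memLp_cellInd (i : Fin n) : MemLp (G.cellInd i) 2 (volume : Measure I) :=
  (memLp_const (1 : ℝ)).indicator (G.measurableSet_cell i)

/-- A step kernel has finite rank; this is what makes the induced shift compact. -/
theorem shift_inducedGraphon_mem_span (X : L2I) :
    G.inducedGraphon.shift X ∈
      Submodule.span ℝ (Set.range fun j => (G.memLp_cellInd j).toLp (G.cellInd j)) := by
  have hint : ∀ i, Integrable (fun u => G.cellInd i u * X u) volume := fun i =>
    (G.memLp_cellInd i).integrable_mul (Lp.memLp X)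
  have hcoe : G.inducedGraphon.shift X = ∑ j, (∑ i, G.gso i j * ∫ u, G.cellInd i u * X u) •
      (G.memLp_cellInd j).toLp (G.cellInd j) := by
    refine Lp.ext ?_
    have hall : ∀ᵐ v, ∀ j, (G.memLp_cellInd j).toLp (G.cellInd j) v = G.cellInd j v :=
      ae_all_iff.mpr fun j => (G.memLp_cellInd j).coeFn_toLp
    have hsmul : ∀ᵐ v, ∀ j, ((∑ i, G.gso i j * ∫ u, G.cellInd i u * X u) •
        (G.memLp_cellInd j).toLp (G.cellInd j) : L2I) v =
        (∑ i, G.gso i j * ∫ u, G.cellInd i u * X u) *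
          (G.memLp_cellInd j).toLp (G.cellInd j) v :=
      ae_all_iff.mpr fun j => Lp.coeFn_smul _ _
    filter_upwards [G.inducedGraphon.shift_coeFn X, hall, hsmul, Lp.coeFn_finsetSum Finset.univ
      fun j => (∑ i, G.gso i j * ∫ u, G.cellInd i u * X u) •
        (G.memLp_cellInd j).toLp (G.cellInd j)] with v h1 h2 h3 h4
    rw [h1, h4, Finset.sum_apply]
    simp only [h3, h2]
    have : ∀ u, G.inducedGraphon u v * X u =
        ∑ j, ∑ i, G.gso i j * G.cellInd j v * (G.cellInd i u * X u) := fun u => by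
      change (∑ i, ∑ j, G.gso i j * G.cellInd i u * G.cellInd j v) * X u = _
      rw [Finset.sum_comm]
      simp only [Finset.sum_mul]
      refine Finset.sum_congr rfl fun j _ => Finset.sum_congr rfl fun i _ => ?_
      ring
    simp only [this]
    rw [integral_finsetSum _ fun j _ => integrable_finsetSum _ fun i _ => (hint i).const_mul _]
    refine Finset.sum_congr rfl fun j _ => ?_
    rw [integral_finsetSum _ fun i _ => (hint i).const_mul _, Finset.sum_mul]
    refine Finset.sum_congr rfl fun i _ => ?_
    rw [integral_const_mul]
    ring
  rw [hcoe]
  exact Submodule.sum_mem _ fun j _ =>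
    Submodule.smul_mem _ _ (Submodule.subset_span (Set.mem_range_self j))

theorem isCompactOperator_shift_inducedGraphon : IsCompactOperator G.inducedGraphon.shift := by
  let V := Submodule.span ℝ (Set.range fun j => (G.memLp_cellInd j).toLp (G.cellInd j))
  have : FiniteDimensional ℝ V := FiniteDimensional.span_of_finite ℝ (Set.finite_range _)
  let f : L2I →L[ℝ] V := G.inducedGraphon.shift.codRestrict V G.shift_inducedGraphon_mem_span
  have hf : IsCompactOperator (id ∘ f : L2I → V) := isCompactOperator_id.comp_clm f
  exact hf.clm_comp V.subtypeL

theorem exists_mem_cell (hn : 0 < n) (t : I) : ∃ i, t ∈ G.cell i := by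
  -- The cell is that of the last candidate; node 0 always qualifies, which covers the points below
  -- the smallest label.
  let s : Finset (Fin n) := Finset.univ.filter fun i => i.val = 0 ∨ G.label i ≤ t
  have hs : s.Nonempty := ⟨⟨0, hn⟩, by simp [s]⟩
  refine ⟨s.max' hs, ?_, fun hi => ?_⟩
  · simpa [s] using s.max'_mem hs
  · by_contra hlt
    have hmem : (⟨(s.max' hs).val + 1, hi⟩ : Fin n) ∈ s := by
      simpa [s] using hlt
    have := s.le_max' _ hmem
    rw [Fin.le_def] at this
    simp at this

theorem cellInd_of_mem {i : Fin n} {t : I} (h : t ∈ G.cell i) (j : Fin n) :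
    G.cellInd j t = if j = i then 1 else 0 := by
  split_ifs with hj
  · subst hj
    exact Set.indicator_of_mem h _
  · refine Set.indicator_of_notMem ?_ _
    rcases lt_or_gt_of_ne hj with hlt | hlt
    · exact fun h' => G.cell_disjoint hlt h' h
    · exact G.cell_disjoint hlt h

theorem inducedGraphon_of_mem {i j : Fin n} {u v : I} (hu : u ∈ G.cell i) (hv : v ∈ G.cell j) :
    G.inducedGraphon u v = G.gso i j := by
  change ∑ i, ∑ j, G.gso i j * G.cellInd i u * G.cellInd j v = _
  simp [G.cellInd_of_mem hu, G.cellInd_of_mem hv]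

theorem inducedSignal_of_mem (x : Fin n → ℝ) {i : Fin n} {t : I} (ht : t ∈ G.cell i) :
    G.inducedSignal x t = x i := by
  change ∑ i, x i * G.cellInd i t = _
  simp [G.cellInd_of_mem ht]

end LabeledGraph

/-! ### Approximation by sampling at dense labels -/

/-- Every point of `[0,1]` is within `ε` of the label of its node. -/
def LabeledGraph.IsFine {n : ℕ} (G : LabeledGraph n) (ε : ℝ) : Prop :=
  ∀ i, ∀ t ∈ G.cell i, |(t : ℝ) - G.label i| ≤ ε

theorem abs_inducedGraphon_weightedGraph_sub_le {W : Graphon} {A : ℝ} (hA : 0 ≤ A)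
    (hW : ∀ u₁ v₁ u₂ v₂ : I,
      |W u₂ v₂ - W u₁ v₁| ≤ A * (|(u₂ : ℝ) - u₁| + |(v₂ : ℝ) - v₁|))
    {n : ℕ} (hn : 0 < n) (U : Fin n → I) {ε : ℝ} (hε : (weightedGraph W U).IsFine ε) (u v : I) :
    |(weightedGraph W U).inducedGraphon u v - W u v| ≤ 2 * A * ε := by
  obtain ⟨i, hi⟩ := (weightedGraph W U).exists_mem_cell hn u
  obtain ⟨j, hj⟩ := (weightedGraph W U).exists_mem_cell hn v
  rw [LabeledGraph.inducedGraphon_of_mem _ hi hj, abs_sub_comm]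
  refine (hW ((weightedGraph W U).label i) ((weightedGraph W U).label j) u v).trans ?_
  have h1 := hε i u hi
  have h2 := hε j v hj
  nlinarith

theorem norm_inducedSignal_sub_le {X : GraphonSignal} {A : ℝ} (hA : 0 ≤ A)
    (hX : ∀ u v : I, |X u - X v| ≤ A * |(u : ℝ) - v|)
    {n : ℕ} (hn : 0 < n) (G : LabeledGraph n) {ε : ℝ} (hε0 : 0 ≤ ε) (hε : G.IsFine ε) :
    ‖(G.inducedSignal (G.sampledSignal X)).toL2 - X.toL2‖ ≤ A * ε := by
  refine L2I.norm_le_of_ae_bound (by positivity) ?_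
  filter_upwards [Lp.coeFn_sub (G.inducedSignal (G.sampledSignal X)).toL2 X.toL2,
    (G.inducedSignal (G.sampledSignal X)).memLp'.coeFn_toLp, X.memLp'.coeFn_toLp] with t h1 h2 h3
  have h2' : (G.inducedSignal (G.sampledSignal X)).toL2 t =
    G.inducedSignal (G.sampledSignal X) t := h2
  have h3' : X.toL2 t = X t := h3
  obtain ⟨i, hi⟩ := G.exists_mem_cell hn t
  rw [h1, Pi.sub_apply, h2', h3', G.inducedSignal_of_mem _ hi, abs_sub_comm]
  exact (hX _ _).trans (mul_le_mul_of_nonneg_left (hε i t hi) hA)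

/-- A point farther than ε from the label of its node would leave room for a window of length ε
strictly between the two. A label in that window contradicts membership in the cell: it lies between
the label and the point, or, below the smallest label, it would be smaller still. -/
theorem isFine_weightedGraph (W : Graphon) {n : ℕ} (U : Fin n → I) {ε : ℝ}
    (h : ∀ a : ℝ, 0 ≤ a → a + ε ≤ 1 → ∃ j, (U j : ℝ) ∈ Set.Icc a (a + ε)) :
    (weightedGraph W U).IsFine ε := by
  set G := weightedGraph W U with hG
  have hlabel : ∀ a : ℝ, 0 ≤ a → a + ε ≤ 1 → ∃ j, (G.label j : ℝ) ∈ Set.Icc a (a + ε) := by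
    intro a ha ha1
    obtain ⟨j, hj⟩ := h a ha ha1
    refine ⟨(Tuple.sort U).symm j, ?_⟩
    simpa [hG, weightedGraph] using hj
  intro i t ht
  by_contra! hlt
  rcases le_or_gt (G.label i) t with hle | hgt
  · have hle' : (G.label i : ℝ) ≤ t := hle
    rw [abs_of_nonneg (by linarith)] at hlt
    -- The window is centred at the midpoint of label and point, so that both end inequalities are
    -- strict.
    obtain ⟨j, hj1, hj2⟩ := hlabel (((G.label i : ℝ) + t - ε) / 2)
      (by linarith [(G.label i).2.1]) (by linarith [t.2.2])
    have hij : G.label i < G.label j := by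
      rw [← Subtype.coe_lt_coe]
      linarith
    have hij' : i.val + 1 ≤ j.val := G.label_mono.reflect_lt hij
    have h1 : i.val + 1 < n := lt_of_le_of_lt hij' j.2
    have h2 : (t : ℝ) < G.label ⟨i.val + 1, h1⟩ := ht.2 h1
    have h3 : (G.label ⟨i.val + 1, h1⟩ : ℝ) ≤ G.label j := G.label_mono hij'
    linarith
  · have hgt' : (t : ℝ) < G.label i := hgt
    rw [abs_of_neg (by linarith)] at hlt
    obtain ⟨j, hj1, hj2⟩ := hlabel (((G.label i : ℝ) + t - ε) / 2)
      (by linarith [t.2.1]) (by linarith [(G.label i).2.2])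
    rcases ht.1 with hi | hi
    · have h3 : (G.label i : ℝ) ≤ G.label j :=
        G.label_mono (Fin.le_def.mpr (by omega))
      linarith
    · exact absurd hgt (not_lt.mpr hi)

theorem exists_fin_div_mem_Icc {n : ℕ} (hn : 0 < n) {a : ℝ} (ha : 0 ≤ a)
    (ha1 : a + 1 / n ≤ 1) : ∃ k : Fin n, ((k : ℕ) : ℝ) / n ∈ Set.Icc a (a + 1 / n) := by
  have hn' : (0 : ℝ) < n := Nat.cast_pos.mpr hn
  have h1 : a * n ≤ ⌈a * n⌉₊ := Nat.le_ceil _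
  have h2 : (⌈a * n⌉₊ : ℝ) < a * n + 1 := Nat.ceil_lt_add_one (by positivity)
  have h3 : a * n + 1 ≤ n := by
    have := mul_le_mul_of_nonneg_right ha1 hn'.le
    rwa [add_mul, one_div_mul_cancel hn'.ne', one_mul] at this
  refine ⟨⟨⌈a * n⌉₊, by exact_mod_cast h2.trans_le h3⟩, ?_, ?_⟩
  · rwa [le_div_iff₀ hn']
  · rw [div_le_iff₀ hn', add_mul, one_div_mul_cancel hn'.ne']
    exact h2.le

/-- Sampling at the deterministic grid k/n gives finite-rank operators that converge in norm. -/
theorem Graphon.isCompactOperator_shift {W : Graphon} {A : ℝ} (hA : 0 ≤ A)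
    (hW : ∀ u₁ v₁ u₂ v₂ : I,
      |W u₂ v₂ - W u₁ v₁| ≤ A * (|(u₂ : ℝ) - u₁| + |(v₂ : ℝ) - v₁|)) :
    IsCompactOperator W.shift := by
  let U : (n : ℕ) → Fin n → I := fun n k =>
    ⟨((k : ℕ) : ℝ) / n, by positivity, div_le_one_of_le₀ (by exact_mod_cast k.2.le) (by positivity)⟩
  have hfine : ∀ n, 0 < n → (weightedGraph W (U n)).IsFine (1 / n) := fun n hn =>
    isFine_weightedGraph W (U n) fun a ha ha1 => exists_fin_div_mem_Icc hn ha ha1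
  refine isCompactOperator_of_tendsto (l := Filter.atTop)
    (F := fun n => (weightedGraph W (U n)).inducedGraphon.shift) ?_
    (Filter.Eventually.of_forall fun n =>
      (weightedGraph W (U n)).isCompactOperator_shift_inducedGraphon)
  rw [tendsto_iff_norm_sub_tendsto_zero]
  refine squeeze_zero' (Filter.Eventually.of_forall fun n => norm_nonneg _)
    (g := fun n : ℕ => 2 * A * (1 / (n : ℝ))) ?_ ?_
  · filter_upwards [Filter.eventually_gt_atTop 0] with n hn
    exact norm_shift_sub_le (by positivity)
      (abs_inducedGraphon_weightedGraph_sub_le hA hW hn (U n) (hfine n hn))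
  · simpa using tendsto_one_div_atTop_nhds_zero_nat.const_mul (2 * A)

/-! ### Random labels hit all grid windows -/

/-- With probability at least `1 - n exp (-n ℓ)`, `n` independent uniform points of `[0,1]` hit all
the intervals `[k/n, k/n + ℓ]` that lie in `[0,1]`. -/
theorem exists_event_hits_windows {Ω : Type*} [MeasurableSpace Ω] (μ : Measure Ω)
    [IsProbabilityMeasure μ] {n : ℕ} (U : Fin n → Ω → I) (hU_meas : ∀ i, Measurable (U i))
    (hU_indep : iIndepFun U μ) (hU_unif : ∀ i, μ.map (U i) = (volume : Measure I))
    {ℓ : ℝ} (hℓ : 0 ≤ ℓ) :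
    ∃ E : Set Ω, MeasurableSet E ∧ ENNReal.ofReal (1 - n * Real.exp (-(n * ℓ))) ≤ μ E ∧
      ∀ ω ∈ E, ∀ k : Fin n, ((k : ℕ) : ℝ) / n + ℓ ≤ 1 →
        ∃ j, (U j ω : ℝ) ∈ Set.Icc (((k : ℕ) : ℝ) / n) (((k : ℕ) : ℝ) / n + ℓ) := by
  let J : Fin n → Set I := fun k =>
    {t | (t : ℝ) ∈ Set.Icc (((k : ℕ) : ℝ) / n) (((k : ℕ) : ℝ) / n + ℓ)}
  have hJ : ∀ k, MeasurableSet (J k) := fun k => measurableSet_Icc.preimage measurable_subtype_coe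
  -- The bad event is empty by construction when the window leaves [0,1]; otherwise its probability
  -- is (1-ℓ)^n ≤ exp(-nℓ).
  let B : Fin n → Set Ω := fun k =>
    {ω | ((k : ℕ) : ℝ) / n + ℓ ≤ 1} ∩ ⋂ j, U j ⁻¹' (J k)ᶜ
  have hB : ∀ k, MeasurableSet (B k) := fun k =>
    (MeasurableSet.const _).inter (MeasurableSet.iInter fun j => hU_meas j (hJ k).compl)
  have hμB : ∀ k, μ (B k) ≤ ENNReal.ofReal (Real.exp (-(n * ℓ))) := by
    intro k
    by_cases hk : ((k : ℕ) : ℝ) / n + ℓ ≤ 1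
    · have hvol : volume (J k) = ENNReal.ofReal ℓ := by
        have h0 : (0 : ℝ) ≤ ((k : ℕ) : ℝ) / n := by positivity
        have : J k = Set.Icc (⟨((k : ℕ) : ℝ) / n, h0, by linarith⟩ : I)
            ⟨((k : ℕ) : ℝ) / n + ℓ, by linarith, hk⟩ := rfl
        rw [this, unitInterval.volume_Icc]
        simp
      have hone : ∀ j, μ (U j ⁻¹' (J k)ᶜ) ≤ ENNReal.ofReal (Real.exp (-ℓ)) := by
        intro j
        rw [← Measure.map_apply (hU_meas j) (hJ k).compl, hU_unif, prob_compl_eq_one_sub (hJ k),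
          hvol, ← ENNReal.ofReal_one, ← ENNReal.ofReal_sub _ hℓ]
        exact ENNReal.ofReal_le_ofReal (Real.one_sub_le_exp_neg ℓ)
      calc μ (B k) ≤ μ (⋂ j, U j ⁻¹' (J k)ᶜ) := measure_mono Set.inter_subset_right
        _ = ∏ j, μ (U j ⁻¹' (J k)ᶜ) :=
            hU_indep.meas_iInter fun j => ⟨(J k)ᶜ, (hJ k).compl, rfl⟩
        _ ≤ ∏ _j : Fin n, ENNReal.ofReal (Real.exp (-ℓ)) :=
            Finset.prod_le_prod' fun j _ => hone j
        _ = ENNReal.ofReal (Real.exp (-(n * ℓ))) := by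
            rw [Finset.prod_const, Finset.card_univ, Fintype.card_fin,
              ← ENNReal.ofReal_pow (Real.exp_pos _).le, ← Real.exp_nat_mul, mul_neg]
    · have : B k = ∅ := by
        ext ω
        simp [B, hk]
      simp [this]
  refine ⟨(⋃ k, B k)ᶜ, (MeasurableSet.iUnion hB).compl, ?_, fun ω hω k hk => ?_⟩
  · rw [prob_compl_eq_one_sub (MeasurableSet.iUnion hB), ENNReal.ofReal_sub _ (by positivity),
      ENNReal.ofReal_one]
    refine tsub_le_tsub_left ((measure_iUnion_fintype_le μ B).trans
      ((Finset.sum_le_sum fun k _ => hμB k).trans ?_)) 1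
    rw [Finset.sum_const, Finset.card_univ, Fintype.card_fin, nsmul_eq_mul,
      ENNReal.ofReal_mul (Nat.cast_nonneg n), ENNReal.ofReal_natCast]
  · by_contra! hmiss
    exact hω (Set.mem_iUnion.mpr ⟨k, hk, Set.mem_iInter.mpr fun j => hmiss j⟩)

/-- Every window of length ℓ + 1/n contains a grid window of length ℓ, so finitely many windows
suffice. -/
theorem isFine_weightedGraph_of_hits_windows (W : Graphon) {n : ℕ} (hn : 0 < n) (U : Fin n → I)
    {ℓ : ℝ} (hℓ : 0 ≤ ℓ) (h : ∀ k : Fin n, ((k : ℕ) : ℝ) / n + ℓ ≤ 1 →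
      ∃ j, (U j : ℝ) ∈ Set.Icc (((k : ℕ) : ℝ) / n) (((k : ℕ) : ℝ) / n + ℓ)) :
    (weightedGraph W U).IsFine (ℓ + 1 / n) := by
  refine isFine_weightedGraph W U fun a ha ha1 => ?_
  obtain ⟨k, hk1, hk2⟩ := exists_fin_div_mem_Icc hn ha (by linarith)
  obtain ⟨j, hj1, hj2⟩ := h k (by linarith)
  exact ⟨j, by linarith, by linarith⟩

/-! ### Lipschitz constants across the bands -/

/-- Concatenation of Lipschitz estimates on adjacent intervals. -/
theorem lipschitz_Icc_union {f : ℝ → ℝ} {A a b d : ℝ}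
    (h1 : ∀ x ∈ Set.Icc a b, ∀ y ∈ Set.Icc a b, |f x - f y| ≤ A * |x - y|)
    (h2 : ∀ x ∈ Set.Icc b d, ∀ y ∈ Set.Icc b d, |f x - f y| ≤ A * |x - y|) :
    ∀ x ∈ Set.Icc a d, ∀ y ∈ Set.Icc a d, |f x - f y| ≤ A * |x - y| := by
  have key : ∀ x ∈ Set.Icc a d, ∀ y ∈ Set.Icc a d, x ≤ y → |f x - f y| ≤ A * |x - y| := by
    intro x hx y hy hxy
    rcases le_total y b with hyb | hyb
    · exact h1 x ⟨hx.1, hxy.trans hyb⟩ y ⟨hy.1, hyb⟩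
    rcases le_total b x with hbx | hbx
    · exact h2 x ⟨hbx, hx.2⟩ y ⟨hyb, hy.2⟩
    have e1 := h1 x ⟨hx.1, hbx⟩ b ⟨hx.1.trans hbx, le_rfl⟩
    have e2 := h2 b ⟨le_rfl, hyb.trans hy.2⟩ y ⟨hyb, hy.2⟩
    rw [abs_of_nonpos (sub_nonpos.mpr hbx)] at e1
    rw [abs_of_nonpos (sub_nonpos.mpr hyb)] at e2
    rw [abs_of_nonpos (sub_nonpos.mpr hxy)]
    calc |f x - f y| ≤ |f x - f b| + |f b - f y| := abs_sub_le _ _ _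
      _ ≤ A * -(x - b) + A * -(b - y) := add_le_add e1 e2
      _ = A * -(x - y) := by ring
  intro x hx y hy
  rcases le_total x y with hxy | hxy
  · exact key x hx y hy hxy
  · rw [abs_sub_comm, abs_sub_comm x]
    exact key y hy x hx hxy

/-- The estimate is a closed condition on pairs. Including the endpoints is what allows gluing at
±c. -/
theorem lipschitz_Icc_of_Ioo {f : ℝ → ℝ} (hf : Continuous f) {A a b : ℝ} (hab : a < b)
    (h : ∀ x ∈ Set.Ioo a b, ∀ y ∈ Set.Ioo a b, |f x - f y| ≤ A * |x - y|) :
    ∀ x ∈ Set.Icc a b, ∀ y ∈ Set.Icc a b, |f x - f y| ≤ A * |x - y| := by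
  intro x hx y hy
  have hclosed : IsClosed {p : ℝ × ℝ | |f p.1 - f p.2| ≤ A * |p.1 - p.2|} :=
    isClosed_le (by fun_prop) (by fun_prop)
  have hsub : Set.Ioo a b ×ˢ Set.Ioo a b ⊆ {p : ℝ × ℝ | |f p.1 - f p.2| ≤ A * |p.1 - p.2|} :=
    fun p hp => h p.1 hp.1 p.2 hp.2
  have := hclosed.closure_subset_iff.mpr hsub
  rw [closure_prod_eq, closure_Ioo hab.ne] at this
  exact this (Set.mk_mem_prod hx hy)

/-- A Lipschitz constant on `[-1,-c] ∪ [c,1]` that dominates one on `(-c,c)` is one on `[-1,1]`. -/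
theorem lipschitz_of_lipschitz_bands {f : ℝ → ℝ} (hf : Continuous f) {A a c : ℝ} (hc0 : 0 < c)
    (haA : a ≤ A)
    (h_high : ∀ x ∈ Set.Icc (-1) (-c) ∪ Set.Icc c 1, ∀ y ∈ Set.Icc (-1) (-c) ∪ Set.Icc c 1,
      |f x - f y| ≤ A * |x - y|)
    (h_low : ∀ x ∈ Set.Ioo (-c) c, ∀ y ∈ Set.Ioo (-c) c, |f x - f y| ≤ a * |x - y|) :
    ∀ x ∈ Set.Icc (-1 : ℝ) 1, ∀ y ∈ Set.Icc (-1 : ℝ) 1, |f x - f y| ≤ A * |x - y| := by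
  have hmid : ∀ x ∈ Set.Icc (-c) c, ∀ y ∈ Set.Icc (-c) c, |f x - f y| ≤ A * |x - y| :=
    lipschitz_Icc_of_Ioo hf (by linarith) fun x hx y hy =>
      (h_low x hx y hy).trans (mul_le_mul_of_nonneg_right haA (abs_nonneg _))
  exact lipschitz_Icc_union (lipschitz_Icc_union
    (fun x hx y hy => h_high x (.inl hx) y (.inl hy)) hmid)
    fun x hx y hy => h_high x (.inr hx) y (.inr hy)

/-! ### Stability of the filter and choice of constants -/

/-- Stability of a polynomial graphon filter under node sampling. -/
theorem norm_filter_sampled_sub_le {W : Graphon} {X : GraphonSignal} {K : ℕ} {h : Fin K → ℝ}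
    {A_w A_h A_x ε : ℝ} (hAw : 0 ≤ A_w) (hAh : 0 ≤ A_h) (hAx : 0 ≤ A_x) (hε : 0 ≤ ε)
    (hW : ∀ u₁ v₁ u₂ v₂ : I,
      |W u₂ v₂ - W u₁ v₁| ≤ A_w * (|(u₂ : ℝ) - u₁| + |(v₂ : ℝ) - v₁|))
    (hh : ∀ x ∈ Set.Icc (-1 : ℝ) 1, ∀ y ∈ Set.Icc (-1 : ℝ) 1,
      |spectralResponse h x - spectralResponse h y| ≤ A_h * |x - y|)
    (hh_le_one : ∀ x ∈ Set.Icc (-1 : ℝ) 1, |spectralResponse h x| ≤ 1)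
    (hX : ∀ u v : I, |X u - X v| ≤ A_x * |(u : ℝ) - v|)
    {n : ℕ} (hn : 0 < n) (U : Fin n → I) (hfine : (weightedGraph W U).IsFine ε) :
    ‖(weightedGraph W U).inducedGraphon.filter h
        ((weightedGraph W U).inducedSignal ((weightedGraph W U).sampledSignal X)).toL2 -
      W.filter h X.toL2‖ ≤ A_h * (2 * A_w * ε) * ‖X.toL2‖ + A_x * ε := by
  set G := weightedGraph W U
  set Xn := (G.inducedSignal (G.sampledSignal X)).toL2
  have hG := G.isCompactOperator_shift_inducedGraphon
  have hlip := norm_aeval_sub_aeval_le hG G.inducedGraphon.isSymmetric_shift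
    G.inducedGraphon.norm_shift_le_one (Graphon.isCompactOperator_shift hAw hW)
    W.isSymmetric_shift W.norm_shift_le_one hAh
    (fun x hx y hy => by
      rw [← spectralResponse_eq_eval h, ← spectralResponse_eq_eval h]
      exact hh x hx y hy)
    (by positivity : 0 ≤ 2 * A_w * ε)
    (fun _ he => Graphon.sum_norm_sq_shift_sub_le (by positivity)
      (abs_inducedGraphon_weightedGraph_sub_le hAw hW hn U hfine) he) X.toL2
  have hcontr := norm_aeval_le_norm_aeval hG G.inducedGraphon.isSymmetric_shift
    G.inducedGraphon.norm_shift_le_one (q := 1)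
    (fun x hx => by
      rw [← spectralResponse_eq_eval h, Polynomial.eval_one, abs_one]
      exact hh_le_one x hx) (Xn - X.toL2)
  rw [← Graphon.filter_eq_aeval, ← Graphon.filter_eq_aeval] at hlip
  rw [← Graphon.filter_eq_aeval, map_one] at hcontr
  have hXn : ‖Xn - X.toL2‖ ≤ A_x * ε := norm_inducedSignal_sub_le hAx hX hn G hε hfine
  -- The operator error acts on `X` itself, so that ‖X‖ and not ‖X_n‖ appears; the signal error
  -- passes through the sampled filter, a contraction.
  have hsplit : G.inducedGraphon.filter h Xn - W.filter h X.toL2 =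
      (G.inducedGraphon.filter h X.toL2 - W.filter h X.toL2) +
        G.inducedGraphon.filter h (Xn - X.toL2) := by
    rw [map_sub]
    abel
  rw [hsplit]
  exact (norm_add_le _ _).trans (add_le_add hlip (hcontr.trans hXn))

/-- With L = log (1-χ)⁻¹ ≤ χ/0.7, the failure probability is bounded by n e L/(n+1)². The factor 0.7
= 1 - 0.3 in the conclusion is a lower bound for 1 - χ₂, and 1 - 2χ₁(1-χ₂) ≥ (1-2χ₁)(1-χ₂). -/
theorem one_le_nodeStochasticity {n : ℕ} (hn : 14 ≤ n) {χ : ℝ} (hχ : χ ∈ Set.Ioc (0 : ℝ) 0.3) :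
    1 ≤ nodeStochasticity n χ ∧
      n * Real.exp (-(nodeStochasticity n χ - 1)) ≤ 2 * χ * 0.7 := by
  obtain ⟨h0, h1⟩ := hχ
  have hn' : (14 : ℝ) ≤ n := by exact_mod_cast hn
  have hinv : 1 < (1 - χ)⁻¹ := (one_lt_inv₀ (by linarith)).mpr (by linarith)
  have hL0 : 0 < Real.log (1 - χ)⁻¹ := Real.log_pos hinv
  have hL : Real.log (1 - χ)⁻¹ ≤ χ / 0.7 := by
    refine (Real.log_le_sub_one_of_pos (by positivity)).trans ?_
    have : (1 - χ)⁻¹ - 1 = χ / (1 - χ) := by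
      field_simp [(by linarith : (1 - χ) ≠ 0)]
      ring
    rw [this]
    exact div_le_div_of_nonneg_left h0.le (by norm_num) (by linarith)
  set L := Real.log (1 - χ)⁻¹
  have hexp : Real.exp 1 < 3 := Real.exp_one_lt_d9.trans (by norm_num)
  have hL1 : L ≤ 1 := hL.trans (by norm_num at h1 ⊢; linarith)
  have hq : 0 < ((n : ℝ) + 1) ^ 2 / L := by positivity
  constructor
  · rw [nodeStochasticity, Real.le_log_iff_exp_le hq, le_div_iff₀ hL0]
    nlinarith
  · rw [neg_sub, Real.exp_sub, nodeStochasticity, Real.exp_log hq, div_div_eq_mul_div,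
      mul_div_assoc', div_le_iff₀ (by positivity)]
    have h2 : Real.exp 1 * L ≤ 3 * (χ / 0.7) :=
      mul_le_mul hexp.le hL hL0.le (by norm_num)
    have h3 : (n : ℝ) * (Real.exp 1 * L) ≤ n * (3 * (χ / 0.7)) :=
      mul_le_mul_of_nonneg_left h2 (by positivity)
    refine h3.trans ?_
    norm_num
    nlinarith [mul_pos h0 (by linarith : (0 : ℝ) < n), mul_nonneg h0.le (sq_nonneg (n : ℝ))]

theorem proposition2 {Ω : Type*} [MeasurableSpace Ω] (μ : Measure Ω) [IsProbabilityMeasure μ]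
    (W : Graphon) (X : GraphonSignal) {K : ℕ} (h : Fin K → ℝ)
    (A_w A_h a_h A_x c : ℝ) (hc0 : 0 < c) (hc1 : c ≤ 1)
    (hW : ∀ u₁ v₁ u₂ v₂ : I,
      |W u₂ v₂ - W u₁ v₁| ≤ A_w * (|(u₂ : ℝ) - u₁| + |(v₂ : ℝ) - v₁|))
    (hh_high : ∀ x ∈ Set.Icc (-1) (-c) ∪ Set.Icc c 1, ∀ y ∈ Set.Icc (-1) (-c) ∪ Set.Icc c 1,
      |spectralResponse h x - spectralResponse h y| ≤ A_h * |x - y|)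
    (hh_low : ∀ x ∈ Set.Ioo (-c) c, ∀ y ∈ Set.Ioo (-c) c,
      |spectralResponse h x - spectralResponse h y| ≤ a_h * |x - y|)
    (ha : a_h < A_h)
    (hh_lt_one : ∀ x ∈ Set.Icc (-1 : ℝ) 1, |spectralResponse h x| < 1)
    (hX : ∀ u v : I, |X u - X v| ≤ A_x * |(u : ℝ) - v|)
    (χ₁ χ₂ : ℝ) (hχ₁ : χ₁ ∈ Set.Ioc (0 : ℝ) 0.3) (hχ₂ : χ₂ ∈ Set.Ioc (0 : ℝ) 0.3)
    (n : ℕ) (hn : 4 / χ₂ ≤ n)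
    (U : Fin n → Ω → I) (hU_meas : ∀ i, Measurable (U i)) (hU_indep : iIndepFun U μ)
    (hU_unif : ∀ i, μ.map (U i) = (volume : Measure I)) :
    ∃ E : Set Ω, MeasurableSet E ∧
      ENNReal.ofReal ((1 - 2 * χ₁) * (1 - χ₂)) ≤ μ E ∧
      ∀ ω ∈ E,
        let G : LabeledGraph n := weightedGraph W fun i => U i ω
        let W_n : Graphon := G.inducedGraphon
        let Y : L2I := W.filter h X.toL2
        let Y_n : L2I := W_n.filter h (G.inducedSignal (G.sampledSignal X)).toL2
        -- if the margin is `0`, the right-hand side of the bound is infinite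
        eigenvalueMargin W W_n c ≠ 0 →
        ‖Y_n - Y‖ ≤
          (A_h + Real.pi * W_n.bandCard c / (eigenvalueMargin W W_n c).toReal) *
              (2 * A_w * nodeStochasticity n χ₁ / n) * ‖X.toL2‖ +
            A_x * nodeStochasticity n χ₁ * (a_h * c + 2) / n +
            2 * a_h * c * ‖X.toL2‖ := by
  
  have hn14 : 14 ≤ n := by
    have h1 : 4 / χ₂ > 13 := by
      rw [gt_iff_lt, lt_div_iff₀ hχ₂.1]
      have := hχ₂.2
      norm_num at this ⊢
      linarith
    have h2 : (13 : ℝ) < n := lt_of_lt_of_le h1 hn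
    exact_mod_cast h2
  have hn0 : 0 < n := by omega
  have hn0' : (0 : ℝ) < n := Nat.cast_pos.mpr hn0
  obtain ⟨hα1, hα2⟩ := one_le_nodeStochasticity hn14 hχ₁
  set α := nodeStochasticity n χ₁
  -- The window length is α/n less the 1/n lost to the grid.
  have hℓ : 0 ≤ (α - 1) / n := div_nonneg (by linarith) hn0'.le
  have hAw : 0 ≤ A_w := by
    have h1 := (abs_nonneg _).trans (hW 0 0 1 0)
    simpa using h1
  have hAx : 0 ≤ A_x := by
    have h1 := (abs_nonneg _).trans (hX 1 0)
    simpa using h1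
  have hah : 0 ≤ a_h := by
    have h1 := (abs_nonneg _).trans
      (hh_low (c / 2) ⟨by linarith, by linarith⟩ 0 ⟨by linarith, hc0⟩)
    rw [sub_zero, abs_of_pos (by linarith)] at h1
    exact nonneg_of_mul_nonneg_left h1 (by linarith)
  have hcont : Continuous (spectralResponse h) := by
    unfold spectralResponse
    fun_prop
  have hlip := lipschitz_of_lipschitz_bands hcont hc0 ha.le hh_high hh_low
  obtain ⟨E, hE, hμE, hhit⟩ := exists_event_hits_windows μ U hU_meas hU_indep hU_unif hℓ
  refine ⟨E, hE, le_trans (ENNReal.ofReal_le_ofReal ?_) hμE, fun ω hω => ?_⟩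
  · rw [mul_div_cancel₀ _ hn0'.ne']
    obtain ⟨h1, h2⟩ := hχ₁
    obtain ⟨h3, h4⟩ := hχ₂
    have h5 := mul_le_mul_of_nonneg_left h4 h1.le
    norm_num at h5 hα2 ⊢
    linarith
  intro G W_n Y Y_n _
  have hfine := isFine_weightedGraph_of_hits_windows W hn0 (fun i => U i ω) hℓ (hhit ω hω)
  have hε : (α - 1) / n + 1 / n = α / n := by ring
  rw [hε] at hfine
  have hε0 : 0 ≤ α / n := div_nonneg (by linarith) hn0'.le
  have hAh : 0 ≤ A_h := hah.trans ha.le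
  have hmain : ‖Y_n - Y‖ ≤ A_h * (2 * A_w * (α / n)) * ‖X.toL2‖ + A_x * (α / n) :=
    norm_filter_sampled_sub_le hAw hAh hAx hε0 hW hlip
      (fun x hx => (hh_lt_one x hx).le) hX hn0 _ hfine
  -- Only the sign matters. For an infinite margin `toReal` is 0 and division by 0 gives 0, in
  -- agreement with the convention inf ∅ = ∞.
  have hextra : 0 ≤ Real.pi * W_n.bandCard c / (eigenvalueMargin W W_n c).toReal := by
    positivity
  have t1 : A_h * (2 * A_w * (α / n)) * ‖X.toL2‖ ≤
      (A_h + Real.pi * W_n.bandCard c / (eigenvalueMargin W W_n c).toReal) *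
        (2 * A_w * α / n) * ‖X.toL2‖ := by
    rw [← mul_div_assoc]
    exact mul_le_mul_of_nonneg_right
      (mul_le_mul_of_nonneg_right (le_add_of_nonneg_right hextra) (by positivity)) (norm_nonneg _)
  have t2 : A_x * (α / n) ≤ A_x * α * (a_h * c + 2) / n := by
    have h1 : 0 ≤ A_x * (α / n) := mul_nonneg hAx hε0
    have h2 : 1 ≤ a_h * c + 2 := by linarith [mul_nonneg hah hc0.le]
    calc A_x * (α / n) ≤ A_x * (α / n) * (a_h * c + 2) := le_mul_of_one_le_right h1 h2
      _ = A_x * α * (a_h * c + 2) / n := by ring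
  have t3 : 0 ≤ 2 * a_h * c * ‖X.toL2‖ := by positivity
  linarith
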